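/- Let $\rho:[0,\infty)\to(0,\infty)$ be an arbitrary positive function with $\rho(x)\to0$ as $x\to\infty$. Then there are a non-decreasing function $S:[0,\infty)\to\mathbb R$ and a constant $a>0$ with the following three properties. (i) The Laplace–Stieltjes transform $$\mathcal L\{dS;s\}=\int_{0^-}^{\infty}e^{-sx}\,dS(x)\qquad(\text{with the convention } S(0^-)=0)$$ converges for every $s\in\mathbb C$ with $\Re s>1$. (ii) The function $\mathcal L\{dS;s\}-\dfrac{a}{s-1}$, defined for $\Re s>1$, admits an extension to $\mathbb C$ as an entire function. (iii) $$\limsup_{x\to\infty}\frac{|S(x)-ae^{x}|}{\rho(x)e^{x}}=\infty.$$ -/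

import Mathlib

open MeasureTheory Filter Topology Set

/-- The right-continuous version of a function `S` that is non-decreasing on `[0, ∞)`,
continued to the left of `0` by the constant `S 0`. -/
noncomputable def stieltjesOfMonotoneOn (S : ℝ → ℝ) (hS : MonotoneOn S (Ici 0)) :
    StieltjesFunction ℝ :=
  Monotone.stieltjesFunction (f := fun x => S (max x 0))
    (fun x y hxy => hS (mem_Ici.2 (le_max_right x 0)) (mem_Ici.2 (le_max_right y 0))
      (max_le_max_right 0 hxy))

/-- The Lebesgue–Stieltjes measure of the increments of `S` on `[0, ∞)`:
it gives `(u, v]` the mass `S(v+) - S(u+)` for `0 ≤ u ≤ v`, the point `0` the mass `S(0+) - S(0)`,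
and `(-∞, 0)` the mass `0`. -/
noncomputable def incrementMeasure (S : ℝ → ℝ) (hS : MonotoneOn S (Ici 0)) : Measure ℝ :=
  (stieltjesOfMonotoneOn S hS).measure

/-- Convergence of the Laplace–Stieltjes integral of `S` at `s`. For the non-negative measure `dS`,
convergence of the improper integral at all real points of an open half-plane `Re s > c` is the
same as absolute convergence at all points of it. -/
def LaplaceStieltjesConverges (S : ℝ → ℝ) (hS : MonotoneOn S (Ici 0)) (s : ℂ) : Prop :=
  Integrable (fun x : ℝ => Complex.exp (-s * x)) (incrementMeasure S hS)

/-- The Laplace–Stieltjes transform `∫_{0⁻}^∞ e^{-s x} dS(x)`, with the usual convention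
`S(0⁻) = 0`: the jump of `S` from `S(0⁻) = 0` to `S(0)` contributes the term `S(0)`. -/
noncomputable def laplaceStieltjes (S : ℝ → ℝ) (hS : MonotoneOn S (Ici 0)) (s : ℂ) : ℂ :=
  (S 0 : ℂ) + ∫ x : ℝ, Complex.exp (-s * x) ∂(incrementMeasure S hS)

/-! Take `S' = e^x (1 + g)` with `g = ∑ c_j φ_j` and `∑ |c_j| ≤ 1`, where `φ_j` is a wave packet of
frequency `ω_j → ∞` centred at `X_j`. Then `|g| ≤ 1` makes `S` monotone, and up to a constant the
transform minus `1/(s-1)` is the Laplace transform of `g` at `s - 1`. Squared width `X/ω` reconciles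
two demands. On `‖s‖ ≤ R`, once `ω ≥ 6R + 2`, the packet's transform is bounded uniformly in `X ≥ 1`
(`norm_wavePacketLaplace_le`), so every summable `c` gives an entire function. Yet for fixed `ω` the
packet flattens to a pure cosine as `X → ∞`, so its contribution to `(S(X) - e^X)/e^X` tends to
`1/(1+ω²)` per unit coefficient (`tendsto_exp_neg_mul_integral_wavePacket`). Choosing `X_k` with
`ρ(X_k)` tiny makes that contribution huge relative to `ρ(X_k)`; Banach–Steinhaus on `ℓ¹` then
supplies one `c` for which the total error is unbounded (`exists_summable_frequently_le_abs_tsum`).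
-/

/-! ### Wave packets and their Laplace transforms. -/

/-- A Gaussian wave packet of frequency `ω` centred at `X`, of squared width `X / ω`. -/
noncomputable def wavePacket (ω X x : ℝ) : ℝ :=
  Real.cos (ω * (x - X)) * Real.exp (-(ω / (2 * X)) * (x - X) ^ 2)

/-- The Laplace transform of a wave packet over the half-line. -/
noncomputable def wavePacketLaplace (ω X : ℝ) (s : ℂ) : ℂ :=
  ∫ x in Ioi (0 : ℝ), Complex.exp (-s * x) * (wavePacket ω X x : ℂ)

theorem continuous_wavePacket (ω X : ℝ) : Continuous (wavePacket ω X) := by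
  unfold wavePacket; fun_prop

theorem abs_wavePacket_le_exp (ω X x : ℝ) :
    |wavePacket ω X x| ≤ Real.exp (-(ω / (2 * X)) * (x - X) ^ 2) := by
  rw [wavePacket, abs_mul, abs_of_pos (Real.exp_pos _)]
  exact mul_le_of_le_one_left (Real.exp_pos _).le (Real.abs_cos_le_one _)

theorem abs_wavePacket_le_one {ω X : ℝ} (hω : 0 < ω) (hX : 0 < X) (x : ℝ) :
    |wavePacket ω X x| ≤ 1 := by
  refine (abs_wavePacket_le_exp ω X x).trans (Real.exp_le_one_iff.2 ?_)
  have : 0 ≤ ω / (2 * X) * (x - X) ^ 2 := by positivity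
  linarith

theorem exp_mul_wavePacket_eq (ω X x : ℝ) (s : ℂ) :
    Complex.exp (-s * x) * (wavePacket ω X x : ℂ) =
      (Complex.exp (-((ω / (2 * X) : ℝ) : ℂ) * x ^ 2 + (-s + Complex.I * ω + (ω / X * X : ℝ)) * x
          + (-(Complex.I * ω * X) - (ω / (2 * X) * X ^ 2 : ℝ))) +
        Complex.exp (-((ω / (2 * X) : ℝ) : ℂ) * x ^ 2 + (-s - Complex.I * ω + (ω / X * X : ℝ)) * x
          + (Complex.I * ω * X - (ω / (2 * X) * X ^ 2 : ℝ)))) / 2 := by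
  rw [wavePacket]
  push_cast
  rw [Complex.cos, div_mul_eq_mul_div, mul_div_assoc', add_mul, mul_add, ← Complex.exp_add,
    ← Complex.exp_add, ← Complex.exp_add, ← Complex.exp_add]
  congr 2 <;> congr 1 <;> ring

theorem integrable_exp_mul_wavePacket {ω X : ℝ} (hω : 0 < ω) (hX : 0 < X) (s : ℂ) :
    Integrable (fun x : ℝ => Complex.exp (-s * x) * (wavePacket ω X x : ℂ)) := by
  have hb : 0 < (((ω / (2 * X) : ℝ) : ℂ)).re := by
    rw [Complex.ofReal_re]; positivity
  simp_rw [exp_mul_wavePacket_eq]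
  exact ((integrable_cexp_quadratic hb _ _).add (integrable_cexp_quadratic hb _ _)).div_const 2

/-- The signs `θ = ±1` are the two exponentials of the cosine. Oscillation yields a factor at most
`e^{-X}`, which absorbs the Gaussian prefactor, crudely at most `2πX`. -/
theorem norm_integral_modulated_gaussian_le {ω X R θ : ℝ} {s : ℂ} (hθ : θ ^ 2 = 1) (hX : 1 ≤ X)
    (hs : ‖s‖ ≤ R) (hω : 6 * R + 2 ≤ ω) :
    ‖∫ x : ℝ, Complex.exp (-((ω / (2 * X) : ℝ) : ℂ) * x ^ 2 +
      (-s + θ * (Complex.I * ω) + (ω / X * X : ℝ)) * x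
      + (-(θ * (Complex.I * ω * X)) - (ω / (2 * X) * X ^ 2 : ℝ)))‖ ≤ 2 * Real.pi := by
  have hR : 0 ≤ R := (norm_nonneg s).trans hs
  have hω0 : 0 < ω := by linarith
  have hX0 : 0 < X := by linarith
  have hωc : (ω : ℂ) ≠ 0 := by exact_mod_cast hω0.ne'
  have hXc : (X : ℂ) ≠ 0 := by exact_mod_cast hX0.ne'
  have hb : (-((ω / (2 * X) : ℝ) : ℂ)).re < 0 := by
    rw [← Complex.ofReal_neg, Complex.ofReal_re]
    have : 0 < ω / (2 * X) := by positivity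
    linarith
  rw [integral_cexp_quadratic hb, norm_mul]
  -- Completing the square: `(1 + θi)² = 2θi` cancels the phase and leaves the decay `-ωX/2`.
  have hexp : (-(θ * (Complex.I * ω * X)) - ((ω / (2 * X) * X ^ 2 : ℝ) : ℂ)) -
      (-s + θ * (Complex.I * ω) + (ω / X * X : ℝ)) ^ 2 / (4 * -((ω / (2 * X) : ℝ) : ℂ)) =
      (X : ℂ) * (-(ω / 2) - s * (1 + θ * Complex.I) + s ^ 2 / (2 * ω)) := by
    have hθc : (θ : ℂ) ^ 2 = 1 := by exact_mod_cast hθ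
    have hI := Complex.I_sq
    push_cast
    field_simp
    linear_combination (norm := ring_nf) 4 * (ω : ℂ) ^ 2 * θ ^ 2 * hI - 4 * (ω : ℂ) ^ 2 * hθc
  rw [hexp, Complex.norm_exp]
  have hre : ((X : ℂ) * (-(ω / 2) - s * (1 + θ * Complex.I) + s ^ 2 / (2 * ω))).re ≤ -X := by
    rw [Complex.re_ofReal_mul]
    have h1 : (-(ω / 2 : ℂ) - s * (1 + θ * Complex.I) + s ^ 2 / (2 * ω)).re ≤
        -(ω / 2) + ‖s * (1 + θ * Complex.I)‖ + ‖s ^ 2 / (2 * ω)‖ := by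
      have e1 := Complex.abs_re_le_norm (s * (1 + θ * Complex.I))
      have e2 := Complex.re_le_norm (s ^ 2 / (2 * ω))
      have e3 : (-(ω / 2 : ℂ)).re = -(ω / 2) := by
        rw [show (-(ω / 2 : ℂ)) = ((-(ω / 2) : ℝ) : ℂ) by push_cast; ring, Complex.ofReal_re]
      rw [Complex.add_re, Complex.sub_re, e3]
      linarith [neg_abs_le (s * (1 + θ * Complex.I)).re]
    have h2 : ‖s * (1 + θ * Complex.I)‖ ≤ 2 * R := by
      rw [norm_mul]
      have : ‖(1 : ℂ) + θ * Complex.I‖ ≤ 2 := by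
        refine (norm_add_le _ _).trans ?_
        have : |θ| = 1 := by rwa [← sq_eq_sq₀ (abs_nonneg _) zero_le_one, sq_abs, one_pow]
        simp [this]; norm_num
      nlinarith [norm_nonneg s, norm_nonneg ((1 : ℂ) + θ * Complex.I)]
    have h3 : ‖s ^ 2 / (2 * (ω : ℂ))‖ ≤ R := by
      rw [norm_div, norm_pow, norm_mul, Complex.norm_real, Real.norm_of_nonneg hω0.le,
        Complex.norm_ofNat, div_le_iff₀ (by positivity)]
      nlinarith [norm_nonneg s]
    nlinarith
  have hpre : ‖((Real.pi : ℂ) / - -((ω / (2 * X) : ℝ) : ℂ)) ^ (1 / 2 : ℂ)‖ ≤ 2 * Real.pi * X := by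
    have hpos : 0 < Real.pi / (ω / (2 * X)) := by positivity
    rw [neg_neg, ← Complex.ofReal_div, Complex.norm_cpow_eq_rpow_re_of_pos hpos]
    have hle : Real.pi / (ω / (2 * X)) ≤ 2 * Real.pi * X := by
      rw [div_le_iff₀ (by positivity)]
      field_simp
      linarith
    have h1 : 1 ≤ 2 * Real.pi * X := by nlinarith [Real.pi_gt_three]
    calc _ ≤ (2 * Real.pi * X) ^ ((1 / 2 : ℂ)).re :=
          Real.rpow_le_rpow hpos.le hle (by norm_num)
      _ ≤ (2 * Real.pi * X) ^ (1 : ℝ) := Real.rpow_le_rpow_of_exponent_le h1 (by norm_num)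
      _ = _ := Real.rpow_one _
  calc _ ≤ 2 * Real.pi * X * Real.exp (-X) := by gcongr
    _ ≤ 2 * Real.pi * (Real.exp X * Real.exp (-X)) := by
      rw [mul_assoc]
      gcongr
      linarith [Real.add_one_le_exp X]
    _ = 2 * Real.pi := by rw [← Real.exp_add]; simp

theorem norm_wavePacketLaplace_le {ω X R : ℝ} {s : ℂ} (hX : 1 ≤ X) (hs : ‖s‖ ≤ R)
    (hω : 6 * R + 2 ≤ ω) : ‖wavePacketLaplace ω X s‖ ≤ 2 * Real.pi + 1 := by
  have hR : 0 ≤ R := (norm_nonneg s).trans hs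
  have hω0 : 0 < ω := by linarith
  have hX0 : 0 < X := by linarith
  have hint := integrable_exp_mul_wavePacket hω0 hX0 s
  have hsplit := integral_add_compl (measurableSet_Iic (a := (0 : ℝ))) hint
  rw [compl_Iic] at hsplit
  have hfull : ‖∫ x : ℝ, Complex.exp (-s * x) * (wavePacket ω X x : ℂ)‖ ≤ 2 * Real.pi := by
    have hb : 0 < (((ω / (2 * X) : ℝ) : ℂ)).re := by
      rw [Complex.ofReal_re]; positivity
    simp_rw [exp_mul_wavePacket_eq]
    rw [integral_div, integral_add (integrable_cexp_quadratic hb _ _)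
      (integrable_cexp_quadratic hb _ _), norm_div, Complex.norm_ofNat, div_le_iff₀ two_pos]
    have h1 := norm_integral_modulated_gaussian_le (θ := 1) (by norm_num) hX hs hω
    have h2 := norm_integral_modulated_gaussian_le (θ := -1) (by norm_num) hX hs hω
    simp only [Complex.ofReal_one, one_mul, Complex.ofReal_neg, neg_one_mul, neg_neg,
      ← sub_eq_add_neg (-s)] at h1 h2
    refine (norm_add_le _ _).trans ?_
    linarith
  have htail : ‖∫ x in Iic (0 : ℝ), Complex.exp (-s * x) * (wavePacket ω X x : ℂ)‖ ≤ 1 := by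
    rw [← integral_exp_Iic_zero]
    refine norm_integral_le_of_norm_le (integrableOn_exp_Iic 0) ?_
    filter_upwards [ae_restrict_mem measurableSet_Iic] with x hx
    have hx : x ≤ 0 := hx
    rw [norm_mul, Complex.norm_exp, Complex.norm_real, Real.norm_eq_abs]
    refine (mul_le_mul_of_nonneg_left (abs_wavePacket_le_exp ω X x) (Real.exp_pos _).le).trans ?_
    rw [← Real.exp_add, Real.exp_le_exp, Complex.re_mul_ofReal, Complex.neg_re]
    have h1 : s.re ≤ R := (Complex.re_le_norm s).trans hs
    -- For `x ≤ 0`, `(x - X)² ≥ -2xX`, so the Gaussian is at most `e^{ωx}` and beats `e^{-sx}`.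
    have h2 : ω * (-x) ≤ ω / (2 * X) * (x - X) ^ 2 := by
      rw [div_mul_eq_mul_div, le_div_iff₀ (by positivity)]
      nlinarith [mul_nonneg hω0.le (sq_nonneg x), mul_nonneg hω0.le (sq_nonneg X)]
    nlinarith
  have : wavePacketLaplace ω X s = (∫ x : ℝ, Complex.exp (-s * x) * (wavePacket ω X x : ℂ)) -
      ∫ x in Iic (0 : ℝ), Complex.exp (-s * x) * (wavePacket ω X x : ℂ) := by
    rw [← hsplit, wavePacketLaplace]; ring
  rw [this]
  exact (norm_sub_le _ _).trans (by linarith)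

theorem differentiable_wavePacketLaplace {ω X : ℝ} (hω : 0 < ω) (hX : 0 < X) :
    Differentiable ℂ (wavePacketLaplace ω X) := by
  intro s₀
  have hcont : Continuous fun x : ℝ => (wavePacket ω X x : ℂ) :=
    Complex.continuous_ofReal.comp (continuous_wavePacket ω X)
  refine (hasDerivAt_integral_of_dominated_loc_of_deriv_le (Metric.ball_mem_nhds s₀ one_pos)
    (F' := fun s (x : ℝ) => Complex.exp (-s * x) * (-x) * (wavePacket ω X x : ℂ))
    -- The shift by 2 pays one unit for the radius of the ball and one for `x ≤ e^x`.
    (bound := fun x : ℝ => ‖Complex.exp (-(s₀ - 2) * x) * (wavePacket ω X x : ℂ)‖)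
    (μ := volume.restrict (Ioi 0))
    (F := fun s (x : ℝ) => Complex.exp (-s * x) * (wavePacket ω X x : ℂ))
    ?_ (integrable_exp_mul_wavePacket hω hX s₀).integrableOn ?_ ?_
    (integrable_exp_mul_wavePacket hω hX (s₀ - 2)).norm.integrableOn ?_).2.differentiableAt
  · exact Eventually.of_forall fun s =>
      (Continuous.mul (by fun_prop) hcont).aestronglyMeasurable
  · exact (Continuous.mul (by fun_prop) hcont).aestronglyMeasurable
  · filter_upwards [ae_restrict_mem measurableSet_Ioi] with x hx s hs
    have hx : 0 < x := hx
    rw [norm_mul, norm_mul, norm_mul]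
    gcongr
    rw [Complex.norm_exp, Complex.norm_exp, norm_neg, Complex.norm_real,
      Real.norm_of_nonneg hx.le]
    have hxe : x ≤ Real.exp x := by linarith [Real.add_one_le_exp x]
    calc _ ≤ Real.exp (-s * x : ℂ).re * Real.exp x := by gcongr
      _ ≤ _ := by
        rw [← Real.exp_add, Real.exp_le_exp, Complex.re_mul_ofReal, Complex.re_mul_ofReal]
        have := Complex.abs_re_le_norm (s - s₀)
        rw [← dist_eq_norm] at this
        have h2 := Metric.mem_ball.1 hs
        have h3 := neg_abs_le (s - s₀).re
        simp only [Complex.sub_re, Complex.neg_re, Complex.re_ofNat] at *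
        nlinarith
  · filter_upwards with x s hs
    have h : HasDerivAt (fun s : ℂ => -s * x) (-x : ℂ) s := by
      simpa using (hasDerivAt_id s).neg.mul_const (x : ℂ)
    exact h.cexp.mul_const _

/-! ### Condensation of singularities in `ℓ¹`. -/

/-- If the diagonal of an infinite matrix with bounded rows is unbounded, the matrix maps some
summable sequence in the unit ball to an unbounded sequence. -/
theorem exists_summable_frequently_le_abs_tsum {A : ℕ → ℕ → ℝ} {B : ℕ → ℝ}
    (hA : ∀ k j, |A k j| ≤ B k) (hdiag : ∀ k : ℕ, (k : ℝ) ≤ |A k k|) :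
    ∃ c : ℕ → ℝ, Summable (fun j => |c j|) ∧ ∑' j, |c j| ≤ 1 ∧
      ∀ M : ℝ, ∃ᶠ k in atTop, M ≤ |∑' j, c j * A k j| := by
  have hsum (c : lp (fun _ : ℕ => ℝ) 1) : HasSum (fun j => |c j|) ‖c‖ := by
    simpa using lp.hasSum_norm (p := 1) (by norm_num) c
  have hB (k : ℕ) : 0 ≤ B k := (abs_nonneg _).trans (hA k 0)
  have hle (c : lp (fun _ : ℕ => ℝ) 1) (k j : ℕ) : ‖c j * A k j‖ ≤ |c j| * B k := by
    rw [norm_mul]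
    exact mul_le_mul_of_nonneg_left (hA k j) (norm_nonneg _)
  have hs (c : lp (fun _ : ℕ => ℝ) 1) (k : ℕ) : Summable fun j => c j * A k j :=
    Summable.of_norm_bounded ((hsum c).summable.mul_right (B k)) (hle c k)
  let T (k : ℕ) : lp (fun _ : ℕ => ℝ) 1 →L[ℝ] ℝ := LinearMap.mkContinuous
    { toFun := fun c => ∑' j, c j * A k j
      map_add' := fun c d => by
        rw [← (hs c k).tsum_add (hs d k)]
        exact tsum_congr fun j => by rw [lp.coeFn_add, Pi.add_apply, add_mul]
      map_smul' := fun r c => by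
        rw [RingHom.id_apply, smul_eq_mul, ← tsum_mul_left]
        exact tsum_congr fun j => by rw [lp.coeFn_smul, Pi.smul_apply, smul_eq_mul, mul_assoc] }
    (B k) (fun c => by
      rw [mul_comm]
      exact tsum_of_norm_bounded ((hsum c).mul_right (B k)) (hle c k))
  have hT (k : ℕ) (c : lp (fun _ : ℕ => ℝ) 1) : T k c = ∑' j, c j * A k j := rfl
  have hunb : ∃ c : lp (fun _ : ℕ => ℝ) 1, ∀ C, ∃ k, C < ‖T k c‖ := by
    by_contra! hcon
    obtain ⟨C, hC⟩ := banach_steinhaus hcon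
    obtain ⟨k, hk⟩ := exists_nat_gt C
    -- Testing on the `k`-th unit vector gives `‖T k‖ ≥ |A k k| ≥ k`, against the uniform bound `C`.
    have h1 : T k (lp.single 1 k 1) = A k k := by
      rw [hT, tsum_eq_single k]
      · simp
      · intro j hj
        simp [hj]
    have h2 := (T k).le_opNorm (lp.single 1 k (1 : ℝ))
    rw [h1, lp.norm_single (by norm_num), norm_one, mul_one, Real.norm_eq_abs] at h2
    linarith [hdiag k, hC k]
  obtain ⟨c, hc⟩ := hunb
  have hr : 0 < ‖c‖ + 1 := by positivity
  set d : lp (fun _ : ℕ => ℝ) 1 := (‖c‖ + 1)⁻¹ • c with hd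
  refine ⟨d, (hsum d).summable, ?_, fun M hM => ?_⟩
  · rw [(hsum d).tsum_eq, hd, norm_smul, norm_inv, Real.norm_of_nonneg hr.le, inv_mul_le_iff₀ hr]
    linarith
  -- An eventual bound would bound the whole sequence, since only finitely many terms precede it.
  · have hbdd : BddAbove (range fun k => ‖T k c‖) := by
      refine IsBoundedUnder.bddAbove_range ⟨(‖c‖ + 1) * M, ?_⟩
      rw [eventually_map]
      filter_upwards [hM] with k hk
      rw [← hT k d, hd, map_smul, smul_eq_mul, abs_mul, abs_inv, abs_of_pos hr, not_le,
        inv_mul_lt_iff₀ hr] at hk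
      exact hk.le
    obtain ⟨C, hC⟩ := hbdd
    obtain ⟨k, hk⟩ := hc C
    exact hk.not_ge (hC (mem_range_self k))

/-! ### The primitive of a packet at its centre. -/

theorem integral_exp_neg_mul_cos_Ioi (ω : ℝ) :
    ∫ v in Ioi (0 : ℝ), Real.exp (-v) * Real.cos (ω * v) = 1 / (1 + ω ^ 2) := by
  have ha : (-1 + Complex.I * ω : ℂ).re < 0 := by simp
  have h := integral_exp_mul_complex_Ioi ha 0
  have hre := integral_re (integrableOn_exp_mul_complex_Ioi ha 0)
  rw [h] at hre
  have hfun : ∀ v : ℝ, RCLike.re (Complex.exp ((-1 + Complex.I * ω) * v)) =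
      Real.exp (-v) * Real.cos (ω * v) := fun v => by
    rw [RCLike.re_to_complex, Complex.exp_re]
    simp
  simp_rw [hfun] at hre
  rw [hre, RCLike.re_to_complex]
  simp [Complex.div_re, Complex.normSq_apply]
  ring

/-- The normalised primitive of `e^u` times a wave packet, evaluated at the centre `X`, tends to a
positive limit that does not depend on `X`. -/
theorem tendsto_exp_neg_mul_integral_wavePacket {ω : ℝ} (hω : 0 < ω) :
    Tendsto (fun X => Real.exp (-X) * ∫ u in (0 : ℝ)..X, Real.exp u * wavePacket ω X u) atTop
      (𝓝 (1 / (1 + ω ^ 2))) := by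
  -- The integrand after `v = X - u`; it is dominated by `e^{-v}`.
  let f (X v : ℝ) : ℝ := Real.exp (-v) * (Real.cos (ω * v) * Real.exp (-(ω / (2 * X)) * v ^ 2))
  have hf (X : ℝ) : Continuous (f X) := by fun_prop
  rw [← integral_exp_neg_mul_cos_Ioi]
  have hlim : Tendsto (fun X => ∫ v in Ioi (0 : ℝ), (Iic X).indicator (f X) v) atTop
      (𝓝 (∫ v in Ioi (0 : ℝ), Real.exp (-v) * Real.cos (ω * v))) := by
    refine tendsto_integral_filter_of_dominated_convergence (fun v => Real.exp (-v)) ?_ ?_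
      (integrableOn_exp_neg_Ioi 0) ?_
    · exact Eventually.of_forall fun X =>
        (hf X).aestronglyMeasurable.indicator measurableSet_Iic
    · filter_upwards [eventually_gt_atTop 0] with X hX
      filter_upwards with v
      refine (norm_indicator_le_norm_self _ _).trans ?_
      rw [norm_mul, Real.norm_of_nonneg (Real.exp_pos _).le, norm_mul,
        Real.norm_of_nonneg (Real.exp_pos (-(ω / (2 * X)) * v ^ 2)).le]
      refine mul_le_of_le_one_right (Real.exp_pos _).le
        (mul_le_one₀ (Real.abs_cos_le_one _) (Real.exp_pos _).le (Real.exp_le_one_iff.2 ?_))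
      have : 0 ≤ ω / (2 * X) * v ^ 2 := by positivity
      linarith
    · filter_upwards with v
      have h1 : Tendsto (fun X : ℝ => -(ω / (2 * X)) * v ^ 2) atTop (𝓝 0) := by
        have : Tendsto (fun X : ℝ => ω / (2 * X)) atTop (𝓝 0) :=
          (tendsto_id.const_mul_atTop two_pos).const_div_atTop ω
        simpa using this.neg.mul_const (v ^ 2)
      have h2 : Tendsto (fun X => f X v) atTop (𝓝 (Real.exp (-v) * Real.cos (ω * v))) := by
        simpa [f] using ((Real.continuous_exp.tendsto 0).comp h1 |>.const_mul
          (Real.cos (ω * v))).const_mul (Real.exp (-v))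
      refine h2.congr' ?_
      filter_upwards [eventually_ge_atTop v] with X hX
      exact (indicator_of_mem (mem_Iic.2 hX) _).symm
  refine hlim.congr' ?_
  filter_upwards [eventually_gt_atTop 0] with X hX
  rw [setIntegral_indicator measurableSet_Iic, Ioi_inter_Iic,
    ← intervalIntegral.integral_of_le hX.le, ← intervalIntegral.integral_const_mul]
  have := intervalIntegral.integral_comp_sub_left (a := 0) (b := X) (f X) X
  rw [sub_self, sub_zero] at this
  rw [← this]
  refine intervalIntegral.integral_congr fun u _ => ?_
  simp only [f, wavePacket]
  rw [show ω * (X - u) = -(ω * (u - X)) by ring, Real.cos_neg,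
    show (X - u) ^ 2 = (u - X) ^ 2 by ring, ← mul_assoc (Real.exp (-X)), ← Real.exp_add,
    show -(X - u) = -X + u by ring]

/-! ### The increment measure of an absolutely continuous `S`. -/

theorem incrementMeasure_eq_withDensity {S h : ℝ → ℝ} (hS : MonotoneOn S (Ici 0))
    (hcont : Continuous h) (hpos : ∀ x, 0 ≤ h x)
    (hSh : ∀ x, 0 ≤ x → S x = S 0 + ∫ u in (0 : ℝ)..x, h u) :
    incrementMeasure S hS =
      (volume.restrict (Ioi 0)).withDensity (fun x => ENNReal.ofReal (h x)) := by
  unfold incrementMeasure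
  refine Measure.ext_of_Ioc _ _ fun a b hab => ?_
  have hint (x y : ℝ) : IntervalIntegrable h volume x y := hcont.intervalIntegrable x y
  have hprim : Continuous fun x => S (max x 0) := by
    have : (fun x => S (max x 0)) = fun x => S 0 + ∫ u in (0 : ℝ)..(max x 0), h u :=
      funext fun x => hSh _ (le_max_right _ _)
    rw [this]
    exact continuous_const.add ((intervalIntegral.continuous_primitive hint 0).comp
      (continuous_id.max continuous_const))
  have hval (x : ℝ) : stieltjesOfMonotoneOn S hS x = S (max x 0) := by
    refine (Monotone.stieltjesFunction_eq _ x).trans ?_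
    exact rightLim_eq_of_tendsto (hprim.tendsto x |>.mono_left nhdsWithin_le_nhds)
  have hset : Ioc a b ∩ Ioi 0 = Ioc (max a 0) (max b 0) := by
    ext x
    simp only [mem_inter_iff, mem_Ioc, mem_Ioi, max_lt_iff, le_max_iff]
    constructor
    · rintro ⟨⟨h1, h2⟩, h3⟩
      exact ⟨⟨h1, h3⟩, Or.inl h2⟩
    · rintro ⟨⟨h1, h3⟩, h2⟩
      exact ⟨⟨h1, h2.resolve_right (not_le.2 h3)⟩, h3⟩
  have hmax : max a 0 ≤ max b 0 := max_le_max_right 0 hab.le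
  rw [StieltjesFunction.measure_Ioc, withDensity_apply _ measurableSet_Ioc,
    Measure.restrict_restrict measurableSet_Ioc, hset, hval, hval, hSh _ (le_max_right b 0),
    hSh _ (le_max_right a 0), add_sub_add_left_eq_sub,
    intervalIntegral.integral_interval_sub_left (hint _ _) (hint _ _),
    intervalIntegral.integral_of_le hmax]
  exact ofReal_integral_eq_lintegral_ofReal (hint _ _).1 (ae_of_all _ hpos)

/-! ### Absolutely convergent superpositions. -/

section Superposition

variable {c : ℕ → ℝ} {φ : ℕ → ℝ → ℝ}

theorem norm_coeff_mul_le (hφ : ∀ j x, |φ j x| ≤ 1) (j : ℕ) (x : ℝ) : ‖c j * φ j x‖ ≤ |c j| := by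
  rw [norm_mul]
  exact mul_le_of_le_one_right (abs_nonneg _) (hφ j x)

theorem continuous_superposition (hc : Summable fun j => |c j|) (hφc : ∀ j, Continuous (φ j))
    (hφ : ∀ j x, |φ j x| ≤ 1) : Continuous fun x => ∑' j, c j * φ j x :=
  continuous_tsum (fun j => continuous_const.mul (hφc j)) hc fun j x => norm_coeff_mul_le hφ j x

theorem abs_superposition_le (hc : Summable fun j => |c j|) (hφ : ∀ j x, |φ j x| ≤ 1) (x : ℝ) :
    |∑' j, c j * φ j x| ≤ ∑' j, |c j| :=
  tsum_of_norm_bounded hc.hasSum fun j => norm_coeff_mul_le hφ j x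

/-- Serves both the Laplace transform (`𝕜 = ℂ`) and the primitive at `X_k` (`𝕜 = ℝ`). -/
theorem hasSum_integral_mul_superposition {𝕜 : Type*} [RCLike 𝕜] {μ : Measure ℝ} {w : ℝ → 𝕜}
    (hc : Summable fun j => |c j|) (hφc : ∀ j, Continuous (φ j)) (hφ : ∀ j x, |φ j x| ≤ 1)
    (hw : Integrable w μ) :
    HasSum (fun j => (c j : 𝕜) * ∫ x, w x * (φ j x : 𝕜) ∂μ)
      (∫ x, w x * ((∑' j, c j * φ j x : ℝ) : 𝕜) ∂μ) := by
  simp_rw [← integral_const_mul]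
  refine hasSum_integral_of_dominated_convergence (fun j x => |c j| * ‖w x‖) (fun j => ?_)
    (fun j => ?_) ?_ ?_ ?_
  · exact (hw.1.mul (RCLike.continuous_ofReal.comp (hφc j)).aestronglyMeasurable).const_mul _
  · filter_upwards with x
    rw [norm_mul, norm_mul, RCLike.norm_ofReal, RCLike.norm_ofReal]
    exact mul_le_mul_of_nonneg_left (mul_le_of_le_one_right (norm_nonneg _) (hφ j x))
      (abs_nonneg _)
  · exact ae_of_all _ fun x => hc.mul_right _
  · simp_rw [tsum_mul_right]
    exact hw.norm.const_mul _
  · filter_upwards with x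
    have h : HasSum (fun j => c j * φ j x) (∑' j, c j * φ j x) :=
      (Summable.of_norm_bounded hc fun j => norm_coeff_mul_le hφ j x).hasSum
    have h' := ((RCLike.hasSum_ofReal (𝕜 := 𝕜)).2 h).mul_left (w x)
    refine h'.congr_fun fun j => ?_
    rw [RCLike.ofReal_mul]
    ring

end Superposition

/-- Weierstrass M-test on each ball: the uniform bound covers all but finitely many packets, and
compactness covers the rest. -/
theorem differentiable_tsum_wavePacketLaplace {c ω X : ℕ → ℝ} (hc : Summable fun j => |c j|)
    (hω : ∀ j, 0 < ω j) (hω_lim : Tendsto ω atTop atTop) (hX : ∀ j, 1 ≤ X j) :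
    Differentiable ℂ fun s => ∑' j, (c j : ℂ) * wavePacketLaplace (ω j) (X j) s := by
  have hF (j : ℕ) := differentiable_wavePacketLaplace (hω j) (zero_lt_one.trans_le (hX j))
  intro s₀
  set R := ‖s₀‖ + 1
  obtain ⟨N, hN⟩ := eventually_atTop.1 (hω_lim.eventually_ge_atTop (6 * R + 2))
  have hbdd (j : ℕ) : ∃ C, ∀ s ∈ Metric.closedBall (0 : ℂ) R,
      ‖wavePacketLaplace (ω j) (X j) s‖ ≤ C :=
    (isCompact_closedBall 0 R).exists_bound_of_continuousOn (hF j).continuous.continuousOn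
  choose C hC using hbdd
  have hbound (j : ℕ) (s : ℂ) (hs : s ∈ Metric.ball (0 : ℂ) R) :
      ‖(c j : ℂ) * wavePacketLaplace (ω j) (X j) s‖ ≤
        |c j| * (2 * Real.pi + 1 + ∑ i ∈ Finset.range N, |C i|) := by
    rw [norm_mul, Complex.norm_real]
    refine mul_le_mul_of_nonneg_left ?_ (abs_nonneg _)
    have hnonneg : 0 ≤ ∑ i ∈ Finset.range N, |C i| := Finset.sum_nonneg fun i _ => abs_nonneg _
    rcases lt_or_ge j N with hj | hj
    · have h1 : |C j| ≤ ∑ i ∈ Finset.range N, |C i| :=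
        Finset.single_le_sum (f := fun i => |C i|) (fun i _ => abs_nonneg _) (Finset.mem_range.2 hj)
      have h2 := hC j s (Metric.ball_subset_closedBall hs)
      linarith [le_abs_self (C j), Real.pi_pos]
    · linarith [norm_wavePacketLaplace_le (hX j) (mem_ball_zero_iff.1 hs).le (hN j hj)]
  refine (Complex.differentiableOn_tsum_of_summable_norm (hc.mul_right _)
    (fun j => ((hF j).const_mul _).differentiableOn) Metric.isOpen_ball hbound).differentiableAt
    (Metric.isOpen_ball.mem_nhds ?_)
  rw [mem_ball_zero_iff]
  linarith

/-! ### Transforms of `e^x (1 + g) dx`. -/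

section Perturbation

variable {g S : ℝ → ℝ}

theorem incrementMeasure_exp_perturbation (hg : Continuous g) (hg1 : ∀ x, |g x| ≤ 1)
    (hS : MonotoneOn S (Ici 0))
    (hSg : ∀ x, 0 ≤ x → S x = S 0 + ∫ u in (0 : ℝ)..x, Real.exp u * (1 + g u)) :
    incrementMeasure S hS = (volume.restrict (Ioi 0)).withDensity
      (fun x => ENNReal.ofReal (Real.exp x * (1 + g x))) :=
  incrementMeasure_eq_withDensity hS (Real.continuous_exp.mul (continuous_const.add hg))
    (fun x => mul_nonneg (Real.exp_pos x).le (by linarith [(abs_le.1 (hg1 x)).1])) hSg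

theorem toReal_density_smul_exp (hg1 : ∀ x, |g x| ≤ 1) (s : ℂ) (x : ℝ) :
    (ENNReal.ofReal (Real.exp x * (1 + g x))).toReal • Complex.exp (-s * x) =
      Complex.exp (-(s - 1) * x) + Complex.exp (-(s - 1) * x) * (g x : ℂ) := by
  rw [ENNReal.toReal_ofReal
    (mul_nonneg (Real.exp_pos x).le (by linarith [(abs_le.1 (hg1 x)).1])), Complex.real_smul,
    show -(s - 1) * x = x + -s * x by ring, Complex.exp_add]
  push_cast
  ring

theorem integrableOn_exp_neg_mul_Ioi {s : ℂ} (hs : 1 < s.re) :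
    IntegrableOn (fun x : ℝ => Complex.exp (-(s - 1) * x)) (Ioi 0) :=
  integrableOn_exp_mul_complex_Ioi (by simpa using hs) 0

theorem integrableOn_exp_neg_mul_bounded {s : ℂ} (hg : Continuous g) (hg1 : ∀ x, |g x| ≤ 1)
    (hs : 1 < s.re) :
    IntegrableOn (fun x : ℝ => Complex.exp (-(s - 1) * x) * (g x : ℂ)) (Ioi 0) :=
  (integrableOn_exp_neg_mul_Ioi hs).mul_bdd
    (Complex.continuous_ofReal.comp hg).aestronglyMeasurable
    (ae_of_all _ fun x => by rw [Complex.norm_real]; exact hg1 x)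

theorem laplaceStieltjesConverges_exp_perturbation (hg : Continuous g) (hg1 : ∀ x, |g x| ≤ 1)
    (hS : MonotoneOn S (Ici 0))
    (hSg : ∀ x, 0 ≤ x → S x = S 0 + ∫ u in (0 : ℝ)..x, Real.exp u * (1 + g u)) {s : ℂ}
    (hs : 1 < s.re) : LaplaceStieltjesConverges S hS s := by
  rw [LaplaceStieltjesConverges, incrementMeasure_exp_perturbation hg hg1 hS hSg,
    integrable_withDensity_iff_integrable_smul' (by fun_prop) (ae_of_all _ fun _ => by simp)]
  simp_rw [toReal_density_smul_exp hg1]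
  exact (integrableOn_exp_neg_mul_Ioi hs).add (integrableOn_exp_neg_mul_bounded hg hg1 hs)

theorem laplaceStieltjes_exp_perturbation (hg : Continuous g) (hg1 : ∀ x, |g x| ≤ 1)
    (hS : MonotoneOn S (Ici 0))
    (hSg : ∀ x, 0 ≤ x → S x = S 0 + ∫ u in (0 : ℝ)..x, Real.exp u * (1 + g u)) {s : ℂ}
    (hs : 1 < s.re) : laplaceStieltjes S hS s =
      S 0 + (1 / (s - 1) + ∫ x in Ioi (0 : ℝ), Complex.exp (-(s - 1) * x) * (g x : ℂ)) := by
  rw [laplaceStieltjes, incrementMeasure_exp_perturbation hg hg1 hS hSg,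
    integral_withDensity_eq_integral_toReal_smul (by fun_prop) (ae_of_all _ fun _ => by simp)]
  simp_rw [toReal_density_smul_exp hg1]
  rw [integral_add (integrableOn_exp_neg_mul_Ioi hs) (integrableOn_exp_neg_mul_bounded hg hg1 hs),
    integral_exp_mul_complex_Ioi (by simpa using hs), Complex.ofReal_zero, mul_zero,
    Complex.exp_zero, neg_div_neg_eq]

end Perturbation

/-! ### Choice of the centres and construction of `S`. -/

/-- `X` is chosen after `ω`: the limit `δ` stays fixed while `ρ X → 0`. -/
theorem exists_wavePacket_centre {ρ : ℝ → ℝ} (hρ_pos : ∀ x : ℝ, 0 ≤ x → 0 < ρ x)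
    (hρ_lim : Tendsto ρ atTop (𝓝 0)) {ω : ℝ} (hω : 0 < ω) (M : ℝ) :
    ∃ X : ℝ, 1 ≤ X ∧ M ≤ X ∧
      M ≤ |(Real.exp (-X) * ∫ u in (0 : ℝ)..X, Real.exp u * wavePacket ω X u) / ρ X| := by
  set δ : ℝ := 1 / (1 + ω ^ 2)
  have hδ : 0 < δ := by positivity
  have hε : 0 < δ / 2 / (|M| + 1) := by positivity
  obtain ⟨X, h1, h2, h3, h4⟩ := ((tendsto_exp_neg_mul_integral_wavePacket hω).eventually_const_lt
    (half_lt_self hδ) |>.and <| (hρ_lim.eventually_lt_const hε).and <|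
    (eventually_ge_atTop 1).and (eventually_ge_atTop M)).exists
  refine ⟨X, h3, h4, ?_⟩
  have hρX := hρ_pos X (by linarith)
  rw [abs_div, abs_of_pos hρX, le_div_iff₀ hρX]
  rw [lt_div_iff₀ (by positivity)] at h2
  have := le_abs_self (Real.exp (-X) * ∫ u in (0 : ℝ)..X, Real.exp u * wavePacket ω X u)
  nlinarith [le_abs_self M, abs_nonneg M]

theorem abs_exp_neg_mul_integral_le_one {φ : ℝ → ℝ} (hφ : ∀ x, |φ x| ≤ 1) {x : ℝ} (hx : 0 ≤ x) :
    |Real.exp (-x) * ∫ u in (0 : ℝ)..x, Real.exp u * φ u| ≤ 1 := by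
  have h : |∫ u in (0 : ℝ)..x, Real.exp u * φ u| ≤ ∫ u in (0 : ℝ)..x, Real.exp u := by
    rw [← Real.norm_eq_abs]
    refine intervalIntegral.norm_integral_le_of_norm_le (μ := volume) hx (ae_of_all _ fun u _ => ?_)
      (Real.continuous_exp.intervalIntegrable _ _)
    rw [norm_mul, Real.norm_of_nonneg (Real.exp_pos u).le]
    exact mul_le_of_le_one_right (Real.exp_pos u).le (hφ u)
  rw [integral_exp, Real.exp_zero] at h
  rw [abs_mul, abs_of_pos (Real.exp_pos _)]
  calc _ ≤ Real.exp (-x) * Real.exp x := by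
        gcongr
        linarith
    _ = 1 := by rw [← Real.exp_add]; simp

theorem corollary1p3 (ρ : ℝ → ℝ) (hρ_pos : ∀ x : ℝ, 0 ≤ x → 0 < ρ x)
    (hρ_lim : Tendsto ρ atTop (𝓝 0)) :
    ∃ (S : ℝ → ℝ) (hS : MonotoneOn S (Ici 0)) (a : ℝ), 0 < a ∧
      (∀ s : ℂ, 1 < s.re → LaplaceStieltjesConverges S hS s) ∧
      (∃ G : ℂ → ℂ, Differentiable ℂ G ∧
        ∀ s : ℂ, 1 < s.re → G s = laplaceStieltjes S hS s - (a : ℂ) / (s - 1)) ∧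
      limsup (fun x : ℝ => ((|S x - a * Real.exp x| / (ρ x * Real.exp x) : ℝ) : EReal)) atTop
        = ⊤ := by
  let ω (k : ℕ) : ℝ := k + 1
  have hω (k : ℕ) : 0 < ω k := by positivity
  have hω_lim : Tendsto ω atTop atTop :=
    tendsto_atTop_add_const_right _ 1 tendsto_natCast_atTop_atTop
  choose X hX1 hXk hXdiag using fun k : ℕ => exists_wavePacket_centre hρ_pos hρ_lim (hω k) k
  have hX0 (k : ℕ) : 0 < X k := zero_lt_one.trans_le (hX1 k)
  let φ (k : ℕ) : ℝ → ℝ := wavePacket (ω k) (X k)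
  have hφc (k : ℕ) : Continuous (φ k) := continuous_wavePacket _ _
  have hφ (k : ℕ) (x : ℝ) : |φ k x| ≤ 1 := abs_wavePacket_le_one (hω k) (hX0 k) x
  obtain ⟨c, hc, hc1, hfreq⟩ := exists_summable_frequently_le_abs_tsum
    (A := fun k j => (Real.exp (-X k) * ∫ u in (0 : ℝ)..X k, Real.exp u * φ j u) / ρ (X k))
    (B := fun k => 1 / ρ (X k))
    (fun k j => by
      rw [abs_div, abs_of_pos (hρ_pos _ (hX0 k).le)]
      exact div_le_div_of_nonneg_right (abs_exp_neg_mul_integral_le_one (hφ j) (hX0 k).le)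
        (hρ_pos _ (hX0 k).le).le) hXdiag
  let g (x : ℝ) : ℝ := ∑' j, c j * φ j x
  have hg : Continuous g := continuous_superposition hc hφc hφ
  have hg1 (x : ℝ) : |g x| ≤ 1 := (abs_superposition_le hc hφ x).trans hc1
  let S (x : ℝ) : ℝ := 1 + ∫ u in (0 : ℝ)..x, Real.exp u * (1 + g u)
  have hcont : Continuous fun u => Real.exp u * (1 + g u) := by fun_prop
  have hS : MonotoneOn S (Ici 0) := fun x _ y _ hxy => by
    have h := intervalIntegral.integral_nonneg (μ := volume) hxy fun u _ =>
      mul_nonneg (Real.exp_pos u).le (show 0 ≤ 1 + g u by linarith [(abs_le.1 (hg1 u)).1])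
    rw [← intervalIntegral.integral_interval_sub_left (hcont.intervalIntegrable 0 y)
      (hcont.intervalIntegrable 0 x)] at h
    simp only [S]
    linarith
  have hS0 : S 0 = 1 := by simp [S]
  have hSg (x : ℝ) (_ : 0 ≤ x) : S x = S 0 + ∫ u in (0 : ℝ)..x, Real.exp u * (1 + g u) := by
    rw [hS0]
  refine ⟨S, hS, 1, one_pos,
    fun s hs => laplaceStieltjesConverges_exp_perturbation hg hg1 hS hSg hs,
    ⟨fun s => 1 + ∑' j, (c j : ℂ) * wavePacketLaplace (ω j) (X j) (s - 1), ?_, fun s hs => ?_⟩, ?_⟩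
  · exact ((differentiable_tsum_wavePacketLaplace hc hω hω_lim hX1).comp
      (differentiable_id.sub_const 1)).const_add 1
  · have h := (hasSum_integral_mul_superposition hc hφc hφ (integrableOn_exp_neg_mul_Ioi hs)).tsum_eq
    rw [laplaceStieltjes_exp_perturbation hg hg1 hS hSg hs, hS0, Complex.ofReal_one,
      add_sub_assoc, add_sub_cancel_left]
    exact congrArg (1 + ·) h
  · refine EReal.eq_top_iff_forall_lt _ |>.2 fun M => ?_
    have hXlim : Tendsto X atTop atTop :=
      tendsto_atTop_mono hXk tendsto_natCast_atTop_atTop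
    refine lt_of_lt_of_le (EReal.coe_lt_coe_iff.2 (lt_add_one M))
      (le_limsup_of_frequently_le' (hXlim.frequently ((hfreq (M + 1)).mono fun k hk => ?_)))
    rw [EReal.coe_le_coe_iff]
    refine hk.trans_eq ?_
    have hsum := (hasSum_integral_mul_superposition (μ := volume.restrict (Ioc 0 (X k))) hc hφc hφ
      (Real.continuous_exp.intervalIntegrable 0 (X k)).1).tsum_eq
    simp only [← intervalIntegral.integral_of_le (hX0 k).le, RCLike.ofReal_real_eq_id, id] at hsum
    have hdiff : S (X k) - 1 * Real.exp (X k) = ∫ u in (0 : ℝ)..X k, Real.exp u * g u := by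
      have hexpg : Continuous fun u => Real.exp u * g u := by fun_prop
      simp only [S, mul_add, mul_one]
      rw [intervalIntegral.integral_add (Real.continuous_exp.intervalIntegrable _ _)
        (hexpg.intervalIntegrable _ _), integral_exp, Real.exp_zero]
      ring
    -- Row `k` of the matrix applied to `c` is exactly the normalised error at `X k`.
    have hA : ∑' j, c j * ((Real.exp (-X k) * ∫ u in (0 : ℝ)..X k, Real.exp u * φ j u) / ρ (X k)) =
        (∫ u in (0 : ℝ)..X k, Real.exp u * g u) / (ρ (X k) * Real.exp (X k)) := by
      rw [← hsum, div_eq_mul_inv, ← tsum_mul_right]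
      refine tsum_congr fun j => ?_
      rw [Real.exp_neg, mul_inv]
      ring
    rw [hA, hdiff, abs_div,
      abs_of_pos (mul_pos (hρ_pos _ (hX0 k).le) (Real.exp_pos (X k)))]
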